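/- Call $(v;k_1,k_2,k_3,k_4;\lambda)$, where $v\ge 1$ and $k_1,k_2,k_3,k_4\ge 0$ are integers and $\lambda$ is an integer, a GS-parameter set (Goethals--Seidel parameter set) if $$\sum_{i=1}^4 k_i(k_i-1)=\lambda(v-1)\quad\text{and}\quad \sum_{i=1}^4 k_i=\lambda+v.$$ For every odd integer $v\ge 1$ there is at least one GS-parameter set $(v;k_1,k_2,k_3,k_4;\lambda)$ with $$\frac{v-1}{2}=k_1\ge k_2\ge k_3\ge k_4\ge 0,$$ and, if $v>1$, with $\lambda\ge 0$. -/

import Mathlib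

/-- `(v; k₁, k₂, k₃, k₄; l)` is a Goethals–Seidel parameter set, where `k₁, …, k₄` are `k 0, …, k 3`.
The numbers `v` and `kᵢ` (a group order and block sizes) are natural numbers. The index `l`
is an integer: for `v = 1` the first condition puts no restriction on it, and for `1 < v`
it forces `0 ≤ l`. -/
structure IsGSParameterSet (v : ℕ) (k : Fin 4 → ℕ) (l : ℤ) : Prop where
  sum_mul_pred : ∑ i, (k i : ℤ) * ((k i : ℤ) - 1) = l * ((v : ℤ) - 1)
  sum_eq : ∑ i, (k i : ℤ) = l + (v : ℤ)

/-!
Completing squares, the two conditions say that `∑ (v - 2 kᵢ)² = 4 v` with `∑ kᵢ = l + v`, so it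
suffices to write `4 v - 1 ≡ 3 (mod 8)` as a sum of three squares; these are necessarily odd.

By Hermite's inequality a positive definite integral form of determinant one in at most five
variables represents `1`, since `(4 / 3) ^ 2 < 2`. Splitting off vectors of square one shows
that it is a sum of squares of integral linear forms. For `n ≡ 3 (mod 8)` it remains to find such a
ternary form representing `n`. Dirichlet's theorem gives a prime `p ≡ 1 (mod 4)` with
`2 p + 1 = d n` and `d ≡ 1 (mod 8)`; quadratic reciprocity gives `t² = 2 p a - d`; and the matrix
with rows `(a, t, 1)`, `(t, 2 p, 0)`, `(1, 0, n)` has determinant `d n - 2 p = 1`.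
-/

open LinearMap (BilinForm ker)
open LinearMap.BilinForm (toMatrix toMatrix_apply)
open Module (Basis Dual)

/- Chio's condensation, with an extra factor `A 0 0` on both sides: the usual exponent `n - 1`
would be truncated at `n = 0`. -/
theorem pow_mul_det_eq_mul_det_condensation {R : Type*} [CommRing R] {n : ℕ}
    (A : Matrix (Fin (n + 1)) (Fin (n + 1)) R) :
    A 0 0 ^ n * A.det = A 0 0 * (Matrix.of fun i j : Fin n =>
      A 0 0 * A i.succ j.succ - A i.succ 0 * A 0 j.succ).det := by
  let scale : Fin (n + 1) → R := Fin.cons 1 fun _ => A 0 0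
  let clear : Fin (n + 1) → R := Fin.cons 0 fun i => -A i.succ 0
  let C : Matrix (Fin (n + 1)) (Fin (n + 1)) R :=
    .of fun i j => scale i * A i j + clear i * A 0 j
  have hC : C.det = A 0 0 ^ n * A.det := by
    rw [Matrix.det_eq_of_forall_row_eq_smul_add_const (A := C)
      (B := .of fun i j => scale i * A i j) clear 0 rfl fun i j => by simp [C, scale],
      Matrix.det_mul_column]
    simp [scale, Fin.prod_univ_succ]
  have hcol (i : Fin n) : C i.succ 0 = 0 := by
    simp only [C, scale, clear, Matrix.of_apply, Fin.cons_succ]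
    ring
  rw [← hC, Matrix.det_succ_column_zero, Fin.sum_univ_succ]
  simp only [hcol, mul_zero, zero_mul, Finset.sum_const_zero, add_zero, Fin.val_zero, pow_zero,
    one_mul]
  congr 2
  · simp [C, scale, clear]
  · ext i j
    simp [C, scale, clear, sub_eq_add_neg]

section SchurForm

variable {R M : Type*} [CommRing R] [AddCommGroup M] [Module R M]

/-- The Schur complement of the vector `e` in the bilinear form `B`, which reduces questions on `B`
to a module of smaller rank. It is scaled by `B e e` to avoid a division, and so remains integral:
for symmetric `B` it is `B e e` times the form induced by `B` on the orthogonal projections along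
`e`. -/
def schurForm (B : BilinForm R M) (e : M) : BilinForm R M :=
  B e e • B - .linMulLin (B.flip e) (B e)

theorem schurForm_apply (B : BilinForm R M) (e x y : M) :
    schurForm B e x y = B e e * B x y - B x e * B e y := by
  simp [schurForm]

theorem isSymm_schurForm {B : BilinForm R M} (hB : B.IsSymm) (e : M) :
    (schurForm B e).IsSymm :=
  ⟨fun x y => by
    rw [schurForm_apply, schurForm_apply, hB.eq x y, hB.eq x e, hB.eq e y]
    ring⟩

theorem schurForm_add_smul_self (B : BilinForm R M) (e x : M) (k : R) :
    schurForm B e (x + k • e) (x + k • e) = schurForm B e x x := by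
  simp only [schurForm_apply, map_add, map_smul, LinearMap.add_apply, LinearMap.smul_apply,
    smul_eq_mul]
  ring

theorem apply_self_mul_schurForm_apply_self (B : BilinForm R M) (e x : M) :
    B e e * schurForm B e x x = B (B e e • x - B e x • e) (B e e • x - B e x • e) := by
  simp only [schurForm_apply, map_sub, map_smul, LinearMap.sub_apply, LinearMap.smul_apply,
    smul_eq_mul]
  ring

theorem posDef_schurForm_restrict_ker [LinearOrder R] [IsStrictOrderedRing R]
    {B : BilinForm R M} (hB : B.toQuadraticMap.PosDef) {f : Dual R M} {e : M} (hf : f e = 1) :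
    ((schurForm B e).restrict (ker f)).toQuadraticMap.PosDef := by
  have he : 0 < B e e := hB e (by rintro rfl; simp at hf)
  rintro ⟨x, hx : f x = 0⟩ hx0
  refine pos_of_mul_pos_right (a := B e e) ?_ he.le
  change 0 < B e e * schurForm B e x x
  rw [apply_self_mul_schurForm_apply_self]
  refine hB _ fun h => ?_
  have hex : B e x = 0 := by simpa [hx, hf] using congrArg f h
  have hBx : 0 < B x x := hB x fun h => hx0 (Subtype.ext h)
  have hBex : 0 < B e e * (B e e * B x x) := by positivity
  refine hBex.ne' ?_
  simpa [hex] using congrArg (fun z => B z z) h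

/-- The basis of `M` formed by `e` and a basis of the kernel of a functional `f` with `f e = 1`. It
completes a primitive vector to a basis, so that `schurForm B e` can be restricted to `ker f`. -/
noncomputable def consKerBasis {f : Dual R M} {e : M} (hf : f e = 1) {n : ℕ}
    (c : Basis (Fin n) R (ker f)) : Basis (Fin (n + 1)) R M :=
  .mkFinCons e c (fun a x (hx : f x = 0) h => by simpa [hf, hx] using congrArg f h)
    fun z => ⟨-f z, by simp [hf]⟩

theorem coe_consKerBasis {f : Dual R M} {e : M} (hf : f e = 1) {n : ℕ}
    (c : Basis (Fin n) R (ker f)) : ⇑(consKerBasis hf c) = Fin.cons e fun i => (c i : M) :=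
  Basis.coe_mkFinCons ..

theorem nonempty_basis_ker [IsDomain R] [IsPrincipalIdealRing R] {f : Dual R M} {e : M}
    (hf : f e = 1) {n : ℕ} (b : Basis (Fin (n + 1)) R M) :
    Nonempty (Basis (Fin n) R (ker f)) := by
  obtain ⟨k, c⟩ := Submodule.basisOfPid b (ker f)
  obtain rfl : k = n := by
    simpa using Fintype.card_congr ((consKerBasis hf c).indexEquiv b)
  exact ⟨c⟩

theorem pow_mul_det_toMatrix_consKerBasis (B : BilinForm R M) {f : Dual R M} {e : M}
    (hf : f e = 1) {n : ℕ} (c : Basis (Fin n) R (ker f)) :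
    B e e ^ n * (toMatrix (consKerBasis hf c) B).det =
      B e e * (toMatrix c ((schurForm B e).restrict (ker f))).det := by
  convert pow_mul_det_eq_mul_det_condensation (toMatrix (consKerBasis hf c) B) using 3
  · simp [toMatrix_apply, coe_consKerBasis]
  · simp [toMatrix_apply, coe_consKerBasis]
  · ext i j
    simp [toMatrix_apply, coe_consKerBasis, schurForm_apply]

theorem exists_dual_apply_eq_one [IsPrincipalIdealRing R] [Module.Free R M]
    {e : M} (he : ∀ (a : R) (x : M), e = a • x → IsUnit a) : ∃ f : Dual R M, f e = 1 := by
  let b := Module.Free.chooseBasis R M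
  obtain ⟨d, hd⟩ := (IsPrincipalIdealRing.principal
    (LinearMap.range (Dual.eval R M e))).principal
  have hdvd (i) : d ∣ b.repr e i := by
    rw [← Ideal.mem_span_singleton, ← Ideal.submodule_span_eq, ← hd]
    exact ⟨b.coord i, rfl⟩
  choose g hg using hdvd
  obtain ⟨u, rfl⟩ := he d (∑ i ∈ (b.repr e).support, g i • b i) (by
    conv_lhs => rw [← b.linearCombination_repr e, Finsupp.linearCombination_apply, Finsupp.sum]
    simp_rw [hg, Finset.smul_sum, mul_smul])
  obtain ⟨f, hf⟩ : (u : R) ∈ LinearMap.range (Dual.eval R M e) := by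
    exact hd ▸ Submodule.mem_span_singleton_self _
  exact ⟨(↑u⁻¹ : R) • f, by
    rw [LinearMap.smul_apply, show f e = u from hf, smul_eq_mul, Units.inv_mul]⟩

end SchurForm

theorem det_toMatrix_eq_det_toMatrix {L ι : Type*} [AddCommGroup L] [Fintype ι] [DecidableEq ι]
    (B : BilinForm ℤ L) (b c : Basis ι ℤ L) : (toMatrix b B).det = (toMatrix c B).det := by
  have hu : (b.toMatrix c).det ^ 2 = 1 := by
    rw [← Basis.det_apply, Int.isUnit_sq (b.isUnit_det c)]
  have h := congrArg Matrix.det (LinearMap.BilinForm.toMatrix_mul_basis_toMatrix b c B)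
  rw [Matrix.det_mul, Matrix.det_mul, Matrix.det_transpose] at h
  linear_combination h - (toMatrix b B).det * hu

theorem apply_self_eq_sum_repr_sq {R M ι : Type*} [CommRing R] [AddCommGroup M] [Module R M]
    [Fintype ι] [DecidableEq ι] {B : BilinForm R M} {c : Basis ι R M} (hc : toMatrix c B = 1)
    (x : M) : B x x = ∑ i, c.repr x i ^ 2 := by
  rw [← Matrix.toBilin_toMatrix c B, hc, Matrix.toBilin_apply]
  simp [Matrix.one_apply, sq]

section Hermite

variable {L : Type*} [AddCommGroup L] {B : BilinForm ℤ L}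

theorem exists_four_mul_add_mul_sq_le {m : ℤ} (hm : m ≠ 0) (t : ℤ) :
    ∃ k : ℤ, 4 * (t + k * m) ^ 2 ≤ m ^ 2 := by
  obtain ⟨k, hk⟩ : m ∣ t.bmod m.natAbs - t := Int.natAbs_dvd.1 Int.dvd_bmod_sub_self
  refine ⟨k, ?_⟩
  have hkt : t + k * m = t.bmod m.natAbs := by linear_combination -hk
  have hlower := Int.le_bmod (x := t) (Int.natAbs_pos.2 hm)
  have hupper := Int.bmod_le (x := t) (Int.natAbs_pos.2 hm)
  have habs : (2 * (t + k * m)).natAbs ≤ m.natAbs := by omega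
  linarith [Int.natAbs_le_iff_sq_le.1 habs]

theorem exists_ne_zero_forall_apply_self_le [Nontrivial L] (hB : B.toQuadraticMap.PosDef) :
    ∃ e ≠ 0, ∀ x ≠ 0, B e e ≤ B x x := by
  have hne : {x : L | x ≠ 0}.Nonempty := exists_ne 0
  let e := Function.argminOn (fun x => (B x x).toNat) {x : L | x ≠ 0} hne
  refine ⟨e, Function.argminOn_mem _ {x : L | x ≠ 0} hne, fun x hx => ?_⟩
  have hx_pos : 0 < B x x := hB x hx
  have hle : (B e e).toNat ≤ (B x x).toNat :=
    Function.argminOn_le (fun x => (B x x).toNat) {x : L | x ≠ 0} hx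
  omega

theorem isUnit_of_eq_smul_of_forall_le (hB : B.toQuadraticMap.PosDef) {e : L} (he : e ≠ 0)
    (hmin : ∀ x ≠ 0, B e e ≤ B x x) (a : ℤ) (x : L) (h : e = a • x) : IsUnit a := by
  subst h
  obtain ⟨ha, hx⟩ : a ≠ 0 ∧ x ≠ 0 := by
    constructor <;> rintro rfl <;> simp at he
  have hxx : 0 < B x x := hB x hx
  have hle : a ^ 2 * B x x ≤ B x x := by
    simpa [sq, mul_assoc] using hmin x hx
  have hsq : a ^ 2 ≤ 1 := le_of_mul_le_mul_right (by simpa using hle) hxx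
  exact .of_pow_eq_one (Int.sq_eq_one_of_sq_le_three (by linarith) ha) two_ne_zero

theorem three_mul_sq_le_four_mul_schurForm (hS : B.IsSymm) (hB : B.toQuadraticMap.PosDef) {e : L}
    (he : e ≠ 0) (hmin : ∀ x ≠ 0, B e e ≤ B x x) {x : L} (hx : ∀ k : ℤ, x + k • e ≠ 0) :
    3 * B e e ^ 2 ≤ 4 * schurForm B e x x := by
  have hee : 0 < B e e := hB e he
  obtain ⟨k, hk⟩ := exists_four_mul_add_mul_sq_le hee.ne' (B e x)
  have hmul : B e e * B e e ≤ B e e * B (x + k • e) (x + k • e) :=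
    mul_le_mul_of_nonneg_left (hmin _ (hx k)) hee.le
  have hey : B e (x + k • e) = B e x + k * B e e := by simp
  rw [← hey] at hk
  rw [← schurForm_add_smul_self B e x k, schurForm_apply, hS.eq (x + k • e) e]
  linarith

theorem hermite_bound_succ {R : Type*} [CommRing R] [LinearOrder R] [IsStrictOrderedRing R]
    {n c : ℕ} {m m' d : R} (hm : 0 < m) (hred : 3 * m ^ 2 ≤ 4 * m')
    (hle : 3 ^ c * m' ^ (n + 1) ≤ 4 ^ c * (m ^ n * d)) :
    3 ^ (n + 1 + c) * m ^ (n + 1 + 1) ≤ 4 ^ (n + 1 + c) * d := by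
  refine le_of_mul_le_mul_left ?_ (pow_pos hm n)
  calc m ^ n * (3 ^ (n + 1 + c) * m ^ (n + 1 + 1))
      = 3 ^ c * (3 * m ^ 2) ^ (n + 1) := by ring
    _ ≤ 3 ^ c * (4 * m') ^ (n + 1) := by gcongr
    _ = 4 ^ (n + 1) * (3 ^ c * m' ^ (n + 1)) := by ring
    _ ≤ 4 ^ (n + 1) * (4 ^ c * (m ^ n * d)) := by gcongr
    _ = m ^ n * (4 ^ (n + 1 + c) * d) := by ring

/- Hermite's inequality `B e e ≤ (4 / 3) ^ (n / 2) * det ^ (1 / (n + 1))` in rank `n + 1`, raised to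
the power `n + 1`. -/
theorem exists_apply_self_pow_le_det {n : ℕ} (b : Basis (Fin (n + 1)) ℤ L)
    (hS : B.IsSymm) (hB : B.toQuadraticMap.PosDef) :
    ∃ e ≠ 0, 3 ^ (n + 1).choose 2 * B e e ^ (n + 1) ≤
      4 ^ (n + 1).choose 2 * (toMatrix b B).det := by
  induction n generalizing L with
  | zero =>
    refine ⟨b 0, b.ne_zero 0, ?_⟩
    simp [toMatrix_apply]
  | succ n ih =>
    have : Nontrivial L := ⟨b 0, 0, b.ne_zero 0⟩
    have : Module.Free ℤ L := .of_basis b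
    obtain ⟨e, he, hmin⟩ := exists_ne_zero_forall_apply_self_le hB
    have hee : 0 < B e e := hB e he
    obtain ⟨f, hf⟩ := exists_dual_apply_eq_one (isUnit_of_eq_smul_of_forall_le hB he hmin)
    obtain ⟨c⟩ := nonempty_basis_ker hf b
    obtain ⟨⟨x, hfx : f x = 0⟩, hx, hle⟩ := ih c ((isSymm_schurForm hS e).restrict _)
      (posDef_schurForm_restrict_ker hB hf)
    change _ * schurForm B e x x ^ _ ≤ _ at hle
    have hred : 3 * B e e ^ 2 ≤ 4 * schurForm B e x x := by
      refine three_mul_sq_le_four_mul_schurForm hS hB he hmin fun k hk => hx ?_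
      obtain rfl : k = 0 := by simpa [hfx, hf] using congrArg f hk
      simpa [Subtype.ext_iff] using hk
    have hdet : (toMatrix c ((schurForm B e).restrict (ker f))).det =
        B e e ^ n * (toMatrix b B).det := by
      refine mul_left_cancel₀ hee.ne' ?_
      rw [← pow_mul_det_toMatrix_consKerBasis B hf, det_toMatrix_eq_det_toMatrix B _ b]
      ring
    rw [hdet] at hle
    rw [Nat.choose_succ_succ', Nat.choose_one_right]
    exact ⟨e, he, hermite_bound_succ hee hred hle⟩

theorem exists_apply_self_eq_one {n : ℕ} (hn : n < 5) (b : Basis (Fin (n + 1)) ℤ L)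
    (hS : B.IsSymm) (hB : B.toQuadraticMap.PosDef) (hdet : (toMatrix b B).det = 1) :
    ∃ e, B e e = 1 := by
  obtain ⟨e, he, hle⟩ := exists_apply_self_pow_le_det b hS hB
  refine ⟨e, le_antisymm ?_ (hB e he)⟩
  by_contra! htwo
  have hpow : (2 : ℤ) ^ (n + 1) ≤ B e e ^ (n + 1) := pow_le_pow_left₀ zero_le_two htwo _
  rw [hdet, mul_one] at hle
  interval_cases n <;> norm_num [Nat.choose] at hle hpow <;> linarith

theorem exists_basis_toMatrix_eq_one {n : ℕ} (hn : n ≤ 5) (b : Basis (Fin n) ℤ L)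
    (hS : B.IsSymm) (hB : B.toQuadraticMap.PosDef) (hdet : (toMatrix b B).det = 1) :
    ∃ c : Basis (Fin n) ℤ L, toMatrix c B = 1 := by
  induction n generalizing L with
  | zero => exact ⟨b, Subsingleton.elim _ _⟩
  | succ n ih =>
    obtain ⟨e, he⟩ := exists_apply_self_eq_one hn b hS hB hdet
    obtain ⟨c⟩ := nonempty_basis_ker he b
    have hrestrict : (schurForm B e).restrict (ker (B e)) = B.restrict (ker (B e)) := by
      ext ⟨x, hx⟩ ⟨y, hy : B e y = 0⟩
      simp [schurForm_apply, he, hy]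
    obtain ⟨c, hc⟩ := ih (Nat.le_of_succ_le hn) c (hS.restrict _)
      (hrestrict ▸ posDef_schurForm_restrict_ker hB he) (by
        rw [← hrestrict, ← one_mul (Matrix.det _), ← he,
          ← pow_mul_det_toMatrix_consKerBasis B he, det_toMatrix_eq_det_toMatrix B _ b, he, hdet]
        simp)
    have hcons (i : Fin n) : B e (c i) = 0 := (c i).2
    refine ⟨consKerBasis he c, Matrix.ext fun i j => ?_⟩
    cases i using Fin.cases <;> cases j using Fin.cases
    · simp [toMatrix_apply, coe_consKerBasis, he]
    · simp [toMatrix_apply, coe_consKerBasis, hcons, (Fin.succ_ne_zero _).symm]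
    · simp [toMatrix_apply, coe_consKerBasis, hS.eq, hcons]
    · simpa [toMatrix_apply, coe_consKerBasis, Matrix.one_apply] using congrFun₂ hc _ _

end Hermite

section ThreeSquares

theorem posDef_toBilin'_of_minors_pos {R : Type*} [CommRing R] [LinearOrder R]
    [IsStrictOrderedRing R] {a b c r s t : R} (ha : 0 < a) (hab : 0 < a * b - t ^ 2)
    (hdet : 0 < !![a, t, s; t, b, r; s, r, c].det) :
    (Matrix.toBilin' !![a, t, s; t, b, r; s, r, c]).toQuadraticMap.PosDef := by
  intro v hv
  set D := !![a, t, s; t, b, r; s, r, c].det with hD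
  let X := a * v 0 + t * v 1 + s * v 2
  let Y := (a * b - t ^ 2) * v 1 + (a * r - s * t) * v 2
  have hsquares : a * (a * b - t ^ 2) *
      (Matrix.toBilin' !![a, t, s; t, b, r; s, r, c]).toQuadraticMap v =
        (a * b - t ^ 2) * X ^ 2 + Y ^ 2 + a * D * v 2 ^ 2 := by
    simp only [hD, X, Y, LinearMap.BilinMap.toQuadraticMap_apply, Matrix.toBilin'_apply,
      Matrix.det_fin_three, Fin.sum_univ_three, Matrix.of_apply, Matrix.cons_val',
      Matrix.cons_val_fin_one, Matrix.cons_val_zero, Matrix.cons_val_one, Matrix.cons_val]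
    ring
  have hX : 0 ≤ (a * b - t ^ 2) * X ^ 2 := by positivity
  have hZ : 0 ≤ a * D * v 2 ^ 2 := by positivity
  refine pos_of_mul_pos_right (a := a * (a * b - t ^ 2)) ?_ (by positivity)
  rw [hsquares]
  refine (add_nonneg (add_nonneg hX (sq_nonneg Y)) hZ).lt_of_ne' fun hzero => hv ?_
  have hv2 : v 2 = 0 := by
    have : a * D * v 2 ^ 2 = 0 := by linarith [sq_nonneg Y]
    simpa [ha.ne', hdet.ne'] using this
  have hv1 : v 1 = 0 := by
    have : Y ^ 2 = 0 := by linarith [sq_nonneg Y]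
    simpa [Y, hv2, hab.ne'] using this
  have hv0 : v 0 = 0 := by
    have : (a * b - t ^ 2) * X ^ 2 = 0 := by linarith [sq_nonneg Y]
    simpa [X, hv1, hv2, hab.ne', ha.ne'] using this
  ext i
  fin_cases i <;> assumption

theorem exists_prime_two_mul_add_one_eq_mul {n : ℕ} (hn : n % 8 = 3) :
    ∃ p d : ℕ, p.Prime ∧ p % 4 = 1 ∧ d % 8 = 1 ∧ 2 * p + 1 = d * n := by
  have hcoprime : ((n - 1) / 2).Coprime (4 * n) := by
    have htwo : ((n - 1) / 2).Coprime 2 := Nat.coprime_two_right.2 (Nat.odd_iff.2 (by omega))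
    have hself : ((n - 1) / 2).Coprime ((n - 1) / 2 * 2 + 1) := by simp
    rw [show (n - 1) / 2 * 2 + 1 = n by omega] at hself
    exact (htwo.pow_right 2).mul_right hself
  obtain ⟨p, hpn, hp, hmod⟩ := Nat.forall_exists_prime_gt_and_modEq n (by omega) hcoprime
  obtain ⟨j, hj⟩ := (Nat.modEq_iff_dvd' (by omega)).1 hmod.symm
  have hpj : p = 4 * (n * j) + (n - 1) / 2 := by rw [← mul_assoc, ← hj]; omega
  refine ⟨p, 8 * j + 1, hp, by omega, by omega, ?_⟩
  have hexpand : (8 * j + 1) * n = 8 * (n * j) + n := by ring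
  omega

theorem jacobiSym_neg_eq_one {p d : ℕ} (hp : p % 4 = 1) (hd : d % 8 = 1)
    (hdvd : (d : ℤ) ∣ 2 * p + 1) : jacobiSym (-d) p = 1 := by
  have hp_odd : Odd p := Nat.odd_iff.2 (by omega)
  have hd_odd : Odd d := Nat.odd_iff.2 (by omega)
  have hneg_one : jacobiSym (-1) d = 1 := by
    rw [jacobiSym.at_neg_one hd_odd, ZMod.χ₄_nat_one_mod_four (by omega)]
  have htwo : jacobiSym 2 d = 1 := by
    rw [jacobiSym.at_two hd_odd, ZMod.χ₈_nat_mod_eight, hd]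
    rfl
  calc jacobiSym (-d) p
      = jacobiSym d p := by
        rw [jacobiSym.neg _ hp_odd, ZMod.χ₄_nat_one_mod_four hp, one_mul]
    _ = jacobiSym 2 d * jacobiSym p d := by
        rw [htwo, one_mul, jacobiSym.quadratic_reciprocity_one_mod_four hp hd_odd]
    _ = jacobiSym (2 * p) d := (jacobiSym.mul_left ..).symm
    _ = jacobiSym (-1) d := jacobiSym.mod_left' <| .symm <| Int.modEq_iff_dvd.2 <| by
        simpa using hdvd
    _ = 1 := hneg_one

theorem exists_dvd_sq_sub_of_jacobiSym_eq_one {p : ℕ} (hp : p.Prime) {a : ℤ}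
    (ha : jacobiSym a p = 1) : ∃ y : ℤ, (p : ℤ) ∣ y ^ 2 - a := by
  have := Fact.mk hp
  obtain ⟨x, hx⟩ := ZMod.isSquare_of_jacobiSym_eq_one ha
  obtain ⟨y, rfl⟩ := ZMod.intCast_surjective x
  refine ⟨y, (ZMod.intCast_zmod_eq_zero_iff_dvd _ _).1 ?_⟩
  push_cast
  rw [hx]
  ring

theorem exists_two_mul_dvd_sq_sub {p a y : ℤ} (hp : Odd p) (ha : Odd a) (hy : p ∣ y ^ 2 - a) :
    ∃ t, 2 * p ∣ t ^ 2 - a := by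
  obtain ⟨t, ht_odd, ht⟩ : ∃ t, Odd t ∧ p ∣ t ^ 2 - a := by
    rcases Int.even_or_odd y with hy_even | hy_odd
    · refine ⟨y + p, hy_even.add_odd hp, ?_⟩
      rw [show (y + p) ^ 2 - a = y ^ 2 - a + p * (2 * y + p) by ring]
      exact dvd_add hy (dvd_mul_right ..)
    · exact ⟨y, hy_odd, hy⟩
  exact ⟨t, (Int.isCoprime_two_left.2 hp).mul_dvd (ht_odd.pow.sub_odd ha).two_dvd ht⟩

theorem exists_sum_three_sq_of_mod_eight_eq_three {n : ℕ} (hn : n % 8 = 3) :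
    ∃ x : Fin 3 → ℤ, ∑ i, x i ^ 2 = n := by
  obtain ⟨p, d, hp, hp4, hd8, hpd⟩ := exists_prime_two_mul_add_one_eq_mul hn
  have hpd' : (2 * p + 1 : ℤ) = d * n := by exact_mod_cast hpd
  have hp_odd : Odd (p : ℤ) := Int.odd_iff.2 (by omega)
  have hd_odd : Odd (-d : ℤ) := Int.odd_iff.2 (by omega)
  obtain ⟨y, hy⟩ := exists_dvd_sq_sub_of_jacobiSym_eq_one hp
    (jacobiSym_neg_eq_one hp4 hd8 ⟨n, hpd'⟩)
  obtain ⟨t, a, ha⟩ := exists_two_mul_dvd_sq_sub hp_odd hd_odd hy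
  let A : Matrix (Fin 3) (Fin 3) ℤ := !![a, t, 1; t, 2 * p, 0; 1, 0, n]
  have hminor : a * (2 * p) - t ^ 2 = d := by linear_combination -ha
  have hdet : A.det = 1 := by
    simp only [A, Matrix.det_fin_three, Matrix.of_apply, Matrix.cons_val', Matrix.cons_val_fin_one,
      Matrix.cons_val_zero, Matrix.cons_val_one, Matrix.cons_val]
    linear_combination n * hminor - hpd'
  have hd_pos : (0 : ℤ) < d := by omega
  have ha_pos : 0 < a := by
    refine pos_of_mul_pos_left (b := 2 * (p : ℤ)) ?_ (by positivity)
    linarith [sq_nonneg t]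
  have hA : (Matrix.toBilin' A).toQuadraticMap.PosDef :=
    posDef_toBilin'_of_minors_pos ha_pos (hminor ▸ hd_pos) (one_pos.trans_eq hdet.symm)
  have hA_symm : (Matrix.toBilin' A).IsSymm := Matrix.isSymm_toBilin'_iff_isSymm.2 <| by
    ext i j
    fin_cases i <;> fin_cases j <;> rfl
  obtain ⟨c, hc⟩ := exists_basis_toMatrix_eq_one (by norm_num) (Pi.basisFun ℤ (Fin 3)) hA_symm hA
    (by
      rw [LinearMap.BilinForm.toMatrix_basisFun, LinearMap.BilinForm.toMatrix'_toBilin', hdet])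
  refine ⟨c.repr (Pi.single 2 1), ?_⟩
  rw [← apply_self_eq_sum_repr_sq hc, Matrix.toBilin'_single]
  rfl

theorem odd_of_sum_three_sq_emod_four_eq_three {x : Fin 3 → ℤ} (hx : (∑ i, x i ^ 2) % 4 = 3)
    (i : Fin 3) : Odd (x i) := by
  have hsq (z : ℤ) : z ^ 2 % 4 = z % 2 := by
    obtain ⟨k, rfl | rfl⟩ := Int.even_or_odd' z <;> ring_nf <;> omega
  have h0 := hsq (x 0)
  have h1 := hsq (x 1)
  have h2 := hsq (x 2)
  rw [Fin.sum_univ_three] at hx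
  rw [Int.odd_iff]
  match i with
  | 0 | 1 | 2 => omega

end ThreeSquares

theorem exists_monotone_odd_sum_four_sq_eq {v : ℕ} (hv : Odd v) :
    ∃ y : Fin 4 → ℕ, y 0 = 1 ∧ Monotone y ∧ (∀ i, Odd (y i)) ∧ ∑ i, y i ^ 2 = 4 * v := by
  rw [Nat.odd_iff] at hv
  obtain ⟨z, hz⟩ := exists_sum_three_sq_of_mod_eight_eq_three (n := 4 * v - 1) (by omega)
  have hz_odd := odd_of_sum_three_sq_emod_four_eq_three (x := z) (by omega)
  let x : Fin 3 → ℕ := fun i => (z i).natAbs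
  let w : Fin 3 → ℕ := x ∘ Tuple.sort x
  have hw_odd (i : Fin 3) : Odd (w i) := (hz_odd _).natAbs
  have hw_sum : ∑ i, w i ^ 2 = 4 * v - 1 := by
    refine (Equiv.sum_comp (Tuple.sort x) fun i => x i ^ 2).trans (Nat.cast_injective (R := ℤ) ?_)
    simpa [x] using hz
  refine ⟨Matrix.vecCons 1 w, rfl, (Tuple.monotone_sort x).vecCons (hw_odd 0).pos, ?_, ?_⟩
  · exact Fin.cases odd_one hw_odd
  · rw [Fin.sum_univ_succ]
    simp only [Matrix.cons_val_zero, Matrix.cons_val_succ, hw_sum]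
    omega

theorem le_of_sq_le_four_mul_of_odd {y v : ℕ} (hy : Odd y) (hv : Odd v) (h : y ^ 2 ≤ 4 * v) :
    y ≤ v := by
  obtain ⟨a, rfl⟩ := hy
  obtain ⟨b, rfl⟩ := hv
  by_contra! hlt
  have hba : b + 1 ≤ a := by omega
  nlinarith

theorem isGSParameterSet_iff {v : ℕ} {k : Fin 4 → ℕ} {l : ℤ} :
    IsGSParameterSet v k l ↔
      ∑ i, ((v : ℤ) - 2 * k i) ^ 2 = (4 * v : ℤ) ∧ ∑ i, (k i : ℤ) = l + v := by
  refine ⟨fun h => ⟨?_, h.sum_eq⟩, fun ⟨hsq, hsum⟩ => ⟨?_, hsum⟩⟩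
  · have h₁ := h.sum_mul_pred
    have h₂ := h.sum_eq
    rw [Fin.sum_univ_four] at h₁ h₂ ⊢
    linear_combination 4 * h₁ + 4 * (1 - v : ℤ) * h₂
  · rw [Fin.sum_univ_four] at hsq hsum ⊢
    refine mul_left_cancel₀ (four_ne_zero' ℤ) ?_
    linear_combination hsq - 4 * (1 - v : ℤ) * hsum

theorem IsGSParameterSet.nonneg {v : ℕ} {k : Fin 4 → ℕ} {l : ℤ} (h : IsGSParameterSet v k l)
    (hv : 1 < v) : 0 ≤ l := by
  refine nonneg_of_mul_nonneg_left (b := (v : ℤ) - 1) ?_ (by omega)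
  rw [← h.sum_mul_pred]
  exact Finset.sum_nonneg fun i _ => by
    rcases (k i).eq_zero_or_pos with hk | hk
    · simp [hk]
    · exact mul_nonneg (by positivity) (by omega)

theorem proposition2 (v : ℕ) (hv : Odd v) :
    ∃ (k : Fin 4 → ℕ) (l : ℤ), IsGSParameterSet v k l ∧
      k 0 = (v - 1) / 2 ∧ k 0 ≥ k 1 ∧ k 1 ≥ k 2 ∧ k 2 ≥ k 3 ∧ (1 < v → 0 ≤ l) := by
  obtain ⟨y, hy0, hmono, hy_odd, hsum⟩ := exists_monotone_odd_sum_four_sq_eq hv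
  have hle (i : Fin 4) : y i ≤ v := by
    refine le_of_sq_le_four_mul_of_odd (hy_odd i) hv (hsum ▸ ?_)
    exact Finset.single_le_sum (f := fun i => y i ^ 2) (by simp) (Finset.mem_univ i)
  let k : Fin 4 → ℕ := fun i => (v - y i) / 2
  have hk (i : Fin 4) : (v : ℤ) - 2 * k i = y i := by
    have htwo : 2 * k i = v - y i := Nat.two_mul_div_two_of_even (hv.tsub_odd (hy_odd i))
    have := hle i
    omega
  have hanti : Antitone k := fun i j hij =>
    Nat.div_le_div_right (Nat.sub_le_sub_left (hmono hij) v)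
  have hGS : IsGSParameterSet v k (∑ i, (k i : ℤ) - v) :=
    isGSParameterSet_iff.2 ⟨by simp_rw [hk]; exact_mod_cast hsum, by ring⟩
  exact ⟨k, _, hGS, by simp [k, hy0], hanti (by decide), hanti (by decide), hanti (by decide),
    hGS.nonneg⟩
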